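/- Let $q$ be a prime power with $q\equiv 3 \pmod 4$, let $\mathbb{F}_q$ and $\mathbb{F}_{q^2}$ be the fields of $q$ and $q^2$ elements, and let $N(z)=z^{q+1}$ be the norm map $\mathbb{F}_{q^2}\to\mathbb{F}_q$. All characters are complex multiplicative characters of the field in question, extended by the value $0$ at $0$ (also for the trivial character). Let $\phi$ be the quadratic character of $\mathbb{F}_q$, and let $M_8$ be a character of $\mathbb{F}_{q^2}$ of order exactly $8$. For a character $C$ of $\mathbb{F}_q$, let $CN$ denote the character $z\mapsto C(N(z))$ of $\mathbb{F}_{q^2}$, and for characters $\alpha,\beta$ of $\mathbb{F}_{q^2}$ let $J_2(\alpha,\beta)=\sum_{z\in\mathbb{F}_{q^2}}\alpha(z)\beta(1-z)$ be the Jacobi sum. Then for every character $\nu$ of $\mathbb{F}_q$, $$\sum_{j,x\in\mathbb{F}_q^*}\phi(j)\,\nu(j)^4\,\phi(x)\,\phi(1-x)\,\phi\bigl(x(j+1)^2+(j-1)^2\bigr)=J_2(\nu N\cdot M_8,\ \phi N)+J_2(\nu N\cdot M_8^5,\ \phi N).$$ -/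

import Mathlib

/-- The quadratic character `φ` of a finite field `F`, with values in `ℂ` (and `φ 0 = 0`). -/
noncomputable def quadChar (F : Type*) [Field F] [Fintype F] [DecidableEq F] : MulChar F ℂ :=
  (quadraticChar F).ringHomComp (Int.castRingHom ℂ)

/-- The character `C N` on `K`: the composition of the character `C` on `F` with the norm map
`N : K → F` of the extension `K / F`. -/
noncomputable def MulChar.compNorm {F : Type*} (K : Type*) [Field F] [Field K] [Finite K]
    [Algebra F K] (C : MulChar F ℂ) : MulChar K ℂ where
  toMonoidHom := C.toMonoidHom.comp (Algebra.norm F : K →* F)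
  map_nonunit' := by
    intro z hz
    have hz0 : z = 0 := by
      by_contra h
      exact hz (isUnit_iff_ne_zero.mpr h)
    subst hz0
    have h0 : Algebra.norm F (0 : K) = 0 := Algebra.norm_zero
    change C (Algebra.norm F (0 : K)) = 0
    rw [h0]
    exact C.map_nonunit not_isUnit_zero

/-! ### The quadratic character of a finite field and its sums. -/

section QuadChar

variable {F : Type*} [Field F] [Fintype F]

/-! `M₈ ^ 4` is the quadratic character of `K`, that is φN, so the two Jacobi sums combine, through
counting square roots, into a sum S of ν(N w)² M₈(w)² φ(N(1 - w²)) over w in `K`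
(`jacobiSum_add_jacobiSum`). Frobenius shows that S is unchanged by the extra weight φ(N w)
(`sum_mul_quadChar_norm`). Hence 2S carries the weight 1 + φ(N w), the number of j with j² = N w,
and S splits over j. For fixed j ≠ 0 put w = jv with N v = 1. On this circle M₈(v)² = φ(N(1 + v))
(`octic_sq_of_norm_eq_one`), and coordinates v = a + bi leave a cubic character sum in a over `F`
(`sum_norm_eq_one`). An affine substitution turns it into the inner sum over x
(`quadChar_mul_sum_cubic`). -/

lemma ringChar_ne_two_of_odd_card (h : Fintype.card F % 2 = 1) : ringChar F ≠ 2 := by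
  intro h2
  have := FiniteField.even_card_iff_char_two.mp h2
  omega

variable [DecidableEq F]

lemma quadChar_sq_apply {a : F} (ha : a ≠ 0) : quadChar F a ^ 2 = 1 := by
  have h := quadraticChar_sq_one ha
  simp only [quadChar, MulChar.ringHomComp_apply, eq_intCast]
  exact_mod_cast h

lemma quadChar_apply_sq {a : F} (ha : a ≠ 0) : quadChar F (a ^ 2) = 1 := by
  rw [map_pow, quadChar_sq_apply ha]

lemma quadChar_isQuadratic : (quadChar F).IsQuadratic :=
  (quadraticChar_isQuadratic F).comp _

lemma quadChar_neg_one (hq : Fintype.card F % 4 = 3) : quadChar F (-1) = -1 := by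
  have h : ¬ IsSquare (-1 : F) := by
    rw [FiniteField.isSquare_neg_one_iff]
    simpa using hq
  have := quadraticChar_neg_one_iff_not_isSquare.mpr h
  simp [quadChar, MulChar.ringHomComp_apply, this]

lemma quadChar_ne_one (hF : ringChar F ≠ 2) : quadChar F ≠ 1 :=
  (MulChar.ringHomComp_ne_one_iff Int.cast_injective).mpr (quadraticChar_ne_one hF)

/-- The number of square roots of `a`, as a sum of indicators. -/
lemma sum_ite_sq_eq (hF : ringChar F ≠ 2) (a : F) :
    ∑ x : F, (if x ^ 2 = a then (1 : ℂ) else 0) = 1 + quadChar F a := by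
  have h := quadraticChar_card_sqrts hF a
  have h' : ((({x : F | x ^ 2 = a}.toFinset.card : ℕ) : ℤ) : ℂ) = ((quadraticChar F a + 1 : ℤ) : ℂ) := by
    rw [h]
  simp only [quadChar, MulChar.ringHomComp_apply, eq_intCast]
  rw [Finset.sum_boole]
  push_cast at h'
  rw [add_comm, ← h']
  congr 2
  ext x
  simp

lemma sum_comp_sq (hF : ringChar F ≠ 2) (g : F → ℂ) :
    ∑ x : F, g (x ^ 2) = ∑ a : F, g a * (1 + quadChar F a) := by
  simp_rw [← sum_ite_sq_eq hF, Finset.mul_sum]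
  rw [Finset.sum_comm]
  simp

/-- The quadratic character is the only character of order two. -/
lemma eq_quadChar_of_sq_eq_one {χ : MulChar F ℂ} (h1 : χ ≠ 1) (h2 : χ ^ 2 = 1)
    (hF : ringChar F ≠ 2) : χ = quadChar F := by
  obtain ⟨g, hg⟩ := IsCyclic.exists_generator (α := Fˣ)
  have key : ∀ ψ : MulChar F ℂ, ψ ≠ 1 → ψ ^ 2 = 1 → ψ g = -1 := by
    intro ψ hψ1 hψ2
    have hs : (ψ g) ^ 2 = 1 := by
      rw [← MulChar.pow_apply_coe, hψ2, MulChar.one_apply_coe]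
    rcases eq_or_eq_neg_of_sq_eq_sq (ψ g) 1 (by rw [hs, one_pow]) with h | h
    · exact absurd ((MulChar.eq_iff hg ψ 1).mpr (by rw [h, MulChar.one_apply_coe])) hψ1
    · exact h
  rw [MulChar.eq_iff hg, key χ h1 h2, key _ (quadChar_ne_one hF) quadChar_isQuadratic.sq_eq_one]

lemma sum_units_eq_sum {g : F → ℂ} (h0 : g 0 = 0) : ∑ u : Fˣ, g u = ∑ x : F, g x := by
  refine Fintype.sum_of_injective (fun u : Fˣ => (u : F)) Units.val_injective _ _ ?_ (fun _ => rfl)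
  intro x hx
  by_cases hx0 : x = 0
  · rw [hx0, h0]
  · exact absurd ⟨Units.mk0 x hx0, rfl⟩ hx

lemma sum_quadChar_mul_quadChar_one_sub (hq : Fintype.card F % 4 = 3) :
    ∑ x : F, quadChar F x * quadChar F (1 - x) = 1 := by
  have hF : ringChar F ≠ 2 := ringChar_ne_two_of_odd_card (by omega)
  have h := jacobiSum_nontrivial_inv (quadChar_ne_one hF)
  rw [quadChar_isQuadratic.inv, quadChar_neg_one hq, neg_neg] at h
  exact h

lemma quadChar_four (hF : ringChar F ≠ 2) : quadChar F 4 = 1 := by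
  have := quadChar_apply_sq (Ring.two_ne_zero hF)
  norm_num at this
  exact this

/-- An affine change of variables between two cubic character sums. -/
lemma quadChar_mul_sum_cubic (hq : Fintype.card F % 4 = 3) {j : F} (hj : j ≠ 0) :
    quadChar F j * ∑ x : F, quadChar F x * quadChar F (1 - x) *
        quadChar F (x * (j + 1) ^ 2 + (j - 1) ^ 2) =
      ∑ a : F, quadChar F (2 + 2 * a) * quadChar F ((1 + j ^ 2) ^ 2 - 4 * j ^ 2 * a ^ 2) := by
  have hF : ringChar F ≠ 2 := ringChar_ne_two_of_odd_card (by omega)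
  have h2 : (2 : F) ≠ 0 := Ring.two_ne_zero hF
  have h4 := quadChar_four hF
  -- At j = -1 the affine substitution degenerates to a constant; there both sides equal -1.
  by_cases hj1 : j = -1
  · subst hj1
    have hL : ∀ x : F, quadChar F x * quadChar F (1 - x) *
        quadChar F (x * (-1 + 1) ^ 2 + (-1 - 1) ^ 2) = quadChar F x * quadChar F (1 - x) := by
      intro x
      have : x * (-1 + 1) ^ 2 + (-1 - 1) ^ 2 = (4 : F) := by ring
      rw [this, h4, mul_one]
    rw [Finset.sum_congr rfl fun x _ => hL x, sum_quadChar_mul_quadChar_one_sub hq,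
      quadChar_neg_one hq]
    have hbij : Function.Bijective fun y : F => 1 - 2 * y := by
      refine Finite.injective_iff_bijective.mp fun y z h => ?_
      have : 2 * y = 2 * z := by linear_combination -h
      exact mul_left_cancel₀ h2 this
    rw [← hbij.sum_comp]
    have hR : ∀ y : F, quadChar F (2 + 2 * (1 - 2 * y)) *
        quadChar F ((1 + (-1) ^ 2) ^ 2 - 4 * (-1) ^ 2 * (1 - 2 * y) ^ 2) =
          quadChar F y - if y = 1 then 1 else 0 := by
      intro y
      have e1 : 2 + 2 * (1 - 2 * y) = 4 * (1 - y) := by ring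
      have e2 : (1 + (-1) ^ 2) ^ 2 - 4 * (-1) ^ 2 * (1 - 2 * y) ^ 2 = 4 * (4 * (y * (1 - y))) := by
        ring
      rw [e1, e2]
      simp only [map_mul, h4]
      split_ifs with hy
      · simp [hy, MulChar.map_zero]
      · have := quadChar_sq_apply (sub_ne_zero.mpr (Ne.symm hy))
        linear_combination quadChar F y * this
    rw [Finset.sum_congr rfl fun y _ => hR y, Finset.sum_sub_distrib,
      MulChar.sum_eq_zero_of_ne_one (quadChar_ne_one hF)]
    simp
  · have hj1' : j + 1 ≠ 0 := fun h => hj1 (eq_neg_of_add_eq_zero_left h)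
    -- This map carries the roots 0, 1, -(j - 1)²/(j + 1)² in x to the roots -1, (1 + j²)/(2j), -(1
    -- + j²)/(2j) in a.
    have hbij : Function.Bijective fun x : F => (1 + j) ^ 2 * x / (2 * j) - 1 := by
      refine Finite.injective_iff_bijective.mp fun y z h => ?_
      have h1j : 1 + j ≠ 0 := by rwa [add_comm]
      have h' : (1 + j) ^ 2 * y / (2 * j) = (1 + j) ^ 2 * z / (2 * j) := by linear_combination h
      field_simp at h'
      exact h'
    rw [← hbij.sum_comp fun a : F => quadChar F (2 + 2 * a) *
      quadChar F ((1 + j ^ 2) ^ 2 - 4 * j ^ 2 * a ^ 2), Finset.mul_sum]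
    refine Finset.sum_congr rfl fun x _ => ?_
    have e1 : 2 + 2 * ((1 + j) ^ 2 * x / (2 * j) - 1) = ((j + 1) / j) ^ 2 * (j * x) := by
      field_simp
      ring
    have e2 : (1 + j ^ 2) ^ 2 - 4 * j ^ 2 * ((1 + j) ^ 2 * x / (2 * j) - 1) ^ 2 =
        (j + 1) ^ 2 * ((1 - x) * (x * (j + 1) ^ 2 + (j - 1) ^ 2)) := by
      field_simp
      ring
    rw [e1, e2, map_mul _ (((j + 1) / j) ^ 2), map_mul _ ((j + 1) ^ 2),
      quadChar_apply_sq (div_ne_zero hj1' hj), quadChar_apply_sq hj1']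
    simp only [map_mul]
    ring

end QuadChar

/-! ### The norm and coordinates of the quadratic extension. -/

section Norm

variable {F K : Type*} [Field F] [Field K] [Algebra F K]

lemma compNorm_apply [Finite K] (C : MulChar F ℂ) (z : K) :
    C.compNorm K z = C (Algebra.norm F z) := rfl

lemma norm_pow_card [Fintype F] (z : K) :
    Algebra.norm F (z ^ Fintype.card F) = Algebra.norm F z := by
  rw [map_pow, FiniteField.pow_card]

end Norm

section Quadratic

variable {F K : Type*} [Field F] [Fintype F] [Field K] [Fintype K] [Algebra F K]

lemma card_eq_sq_of_finrank (hK : Module.finrank F K = 2) :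
    Fintype.card K = Fintype.card F ^ 2 := by
  rw [Module.card_eq_pow_finrank (K := F), hK]

lemma algebraMap_norm_eq (hK : Module.finrank F K = 2) (z : K) :
    algebraMap F K (Algebra.norm F z) = z * z ^ Fintype.card F := by
  rw [FiniteField.algebraMap_norm_eq_pow, Nat.card_eq_fintype_card, Nat.card_eq_fintype_card,
    card_eq_sq_of_finrank hK, ← pow_succ']
  congr 1
  have h1 : 1 < Fintype.card F := Fintype.one_lt_card
  have : Fintype.card F ^ 2 - 1 = (Fintype.card F + 1) * (Fintype.card F - 1) := by
    simpa using Nat.sq_sub_sq (Fintype.card F) 1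
  rw [this, Nat.mul_div_cancel _ (by omega)]

/-- A square root of `-1` gives coordinates on the quadratic extension. -/
lemma exists_coordinates (hq : Fintype.card F % 4 = 3) (hK : Module.finrank F K = 2) :
    ∃ i : K, i ^ 2 = -1 ∧
      (∀ a b : F, Algebra.norm F (algebraMap F K a + algebraMap F K b * i) = a ^ 2 + b ^ 2) ∧
      Function.Bijective fun p : F × F => algebraMap F K p.1 + algebraMap F K p.2 * i := by
  have hcard := card_eq_sq_of_finrank hK
  have hsq : IsSquare (-1 : K) := by
    rw [FiniteField.isSquare_neg_one_iff, hcard, pow_two, Nat.mul_mod, hq]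
    norm_num
  obtain ⟨i, hi⟩ := hsq
  have hi2 : i ^ 2 = -1 := by rw [pow_two, ← hi]
  have hns : ∀ c : F, c ^ 2 ≠ -1 := by
    intro c hc
    exact (FiniteField.isSquare_neg_one_iff.mp ⟨c, by rw [← hc, pow_two]⟩) hq
  -- As q ≡ 3 mod 4, Frobenius acts as the conjugation i ↦ -i.
  have hiq : i ^ Fintype.card F = -i := by
    obtain ⟨k, hk⟩ : ∃ k, Fintype.card F = 2 * (2 * k + 1) + 1 :=
      ⟨Fintype.card F / 4, by omega⟩
    rw [hk, pow_succ, pow_mul, hi2, Odd.neg_one_pow ⟨k, rfl⟩]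
    ring
  refine ⟨i, hi2, fun a b => ?_, ?_⟩
  · apply (algebraMap F K).injective
    have hfrob : (algebraMap F K a + algebraMap F K b * i) ^ Fintype.card F =
        algebraMap F K a - algebraMap F K b * i := by
      have h := map_add (FiniteField.frobeniusAlgHom F K) (algebraMap F K a) (algebraMap F K b * i)
      simp only [map_mul, AlgHom.commutes, FiniteField.coe_frobeniusAlgHom] at h
      rw [h, hiq]
      ring
    rw [algebraMap_norm_eq hK, hfrob]
    simp only [map_add, map_pow]
    linear_combination -(algebraMap F K b) ^ 2 * hi2
  · rw [Fintype.bijective_iff_injective_and_card]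
    refine ⟨?_, by rw [Fintype.card_prod, hcard, pow_two]⟩
    rintro ⟨a, b⟩ ⟨c, d⟩ h
    simp only at h
    have hbd : b = d := by
      by_contra hne
      have hne' : d - b ≠ 0 := sub_ne_zero.mpr (Ne.symm hne)
      refine hns ((a - c) / (d - b)) ?_
      apply (algebraMap F K).injective
      have hne'' : algebraMap F K d - algebraMap F K b ≠ 0 := by
        rw [← map_sub]
        exact (map_ne_zero _).mpr hne'
      have hh : (algebraMap F K a - algebraMap F K c) / (algebraMap F K d - algebraMap F K b) = i := by
        rw [div_eq_iff hne'']
        linear_combination h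
      rw [map_pow, map_div₀, map_sub, map_sub, hh, hi2, map_neg, map_one]
    subst hbd
    have : algebraMap F K a = algebraMap F K c := by linear_combination h
    rw [(algebraMap F K).injective this]

lemma ringChar_ne_two_of_finrank (hq : Fintype.card F % 4 = 3) (hK : Module.finrank F K = 2) :
    ringChar K ≠ 2 := by
  refine ringChar_ne_two_of_odd_card ?_
  rw [card_eq_sq_of_finrank hK, pow_two, Nat.mul_mod]
  have : Fintype.card F % 2 = 1 := by omega
  rw [this]

end Quadratic

/-! ### Values of the octic character. -/

lemma octic_pow_eight {K : Type*} [Field K] {M₈ : MulChar K ℂ} (hM₈ : orderOf M₈ = 8) {z : K} (hz : z ≠ 0) :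
    M₈ z ^ 8 = 1 := by
  have h : M₈ ^ 8 = 1 := by rw [← hM₈, pow_orderOf_eq_one]
  rw [← MulChar.pow_apply' _ (by norm_num), h, MulChar.one_apply hz.isUnit]

/-- 2q ≡ 6 mod 8. -/
lemma octic_pow_card {F K : Type*} [Fintype F] [Field F] [Field K] {M₈ : MulChar K ℂ}
    (hq : Fintype.card F % 4 = 3) (hM₈ : orderOf M₈ = 8) (z : K) :
    M₈ (z ^ Fintype.card F) ^ 2 = M₈ z ^ 6 := by
  have hpos : 0 < Fintype.card F := Fintype.card_pos
  by_cases hz : z = 0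
  · subst hz
    simp [hpos.ne', MulChar.map_zero]
  · obtain ⟨k, hk⟩ : ∃ k, Fintype.card F = 4 * k + 3 := ⟨Fintype.card F / 4, by omega⟩
    rw [map_pow, ← pow_mul, hk, show (4 * k + 3) * 2 = 8 * k + 6 by ring, pow_add, pow_mul,
      octic_pow_eight hM₈ hz, one_pow, one_mul]

section Octic

variable {F K : Type*} [Field F] [Fintype F] [DecidableEq F] [Field K] [Fintype K] [Algebra F K]

lemma quadChar_compNorm [DecidableEq K] (hF : ringChar F ≠ 2) (hFK : ringChar K ≠ 2) :
    (quadChar F).compNorm K = quadChar K := by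
  refine eq_quadChar_of_sq_eq_one ?_ ?_ hFK
  · obtain ⟨a, ha⟩ := MulChar.ne_one_iff.mp (quadChar_ne_one hF)
    obtain ⟨z, hz⟩ := FiniteField.norm_surjective F K a
    have hz0 : z ≠ 0 := by
      rintro rfl
      rw [Algebra.norm_zero] at hz
      exact a.ne_zero hz.symm
    refine MulChar.ne_one_iff.mpr ⟨Units.mk0 z hz0, ?_⟩
    rw [Units.val_mk0, compNorm_apply, hz]
    exact ha
  · ext z
    rw [MulChar.pow_apply_coe, compNorm_apply, MulChar.one_apply_coe,
      quadChar_sq_apply (Algebra.norm_ne_zero_iff.mpr z.ne_zero)]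

variable {M₈ : MulChar K ℂ}

lemma octic_pow_four (hq : Fintype.card F % 4 = 3) (hK : Module.finrank F K = 2)
    (hM₈ : orderOf M₈ = 8) (z : K) : M₈ z ^ 4 = quadChar F (Algebra.norm F z) := by
  classical
  have hF : ringChar F ≠ 2 := ringChar_ne_two_of_odd_card (by omega)
  have hFK := ringChar_ne_two_of_finrank hq hK
  have h1 : M₈ ^ 4 ≠ 1 := pow_ne_one_of_lt_orderOf (by norm_num) (by rw [hM₈]; norm_num)
  have h2 : (M₈ ^ 4) ^ 2 = 1 := by rw [← pow_mul, show 4 * 2 = orderOf M₈ from hM₈.symm, pow_orderOf_eq_one]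
  rw [← MulChar.pow_apply' _ (by norm_num), ← compNorm_apply, quadChar_compNorm hF hFK,
    ← eq_quadChar_of_sq_eq_one h1 h2 hFK]

/-- -1 = i² and N(i) = 1, so M₈(i)⁴ = φ(1). -/
lemma octic_sq_neg_one (hq : Fintype.card F % 4 = 3) (hK : Module.finrank F K = 2)
    (hM₈ : orderOf M₈ = 8) : M₈ (-1) ^ 2 = 1 := by
  obtain ⟨i, hi, hN, -⟩ := exists_coordinates (K := K) hq hK
  have h := octic_pow_four hq hK hM₈ i
  have hNi := hN 0 1
  simp only [map_zero, map_one, zero_add, one_mul] at hNi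
  rw [hNi] at h
  rw [← hi, map_pow, ← pow_mul, h]
  norm_num

/-- Since -1 is not a square in `F`, c = ±s² with s in `F`; and M₈(s)⁴ = φ(N s) = φ(s²) = 1. -/
lemma octic_sq_algebraMap (hq : Fintype.card F % 4 = 3) (hK : Module.finrank F K = 2)
    (hM₈ : orderOf M₈ = 8) {c : F} (hc : c ≠ 0) : M₈ (algebraMap F K c) ^ 2 = 1 := by
  have hsquare : ∀ s : F, s ≠ 0 → M₈ (algebraMap F K (s * s)) ^ 2 = 1 := by
    intro s hs
    have h := octic_pow_four hq hK hM₈ (algebraMap F K s)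
    rw [Algebra.norm_algebraMap, hK, quadChar_apply_sq hs] at h
    rw [map_mul, map_mul, ← pow_two, ← pow_mul, h]
  by_cases h : IsSquare c
  · obtain ⟨s, rfl⟩ := h
    exact hsquare s (by rintro rfl; simp at hc)
  · have h' : IsSquare (-c) := by
      by_contra hn
      have h1 := quadraticChar_neg_one_iff_not_isSquare.mpr h
      have h2 := quadraticChar_neg_one_iff_not_isSquare.mpr hn
      have h3 : ¬ IsSquare (-1 : F) := by
        rw [FiniteField.isSquare_neg_one_iff]
        simpa using hq
      have h4 := quadraticChar_neg_one_iff_not_isSquare.mpr h3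
      rw [← neg_one_mul, map_mul, h1, h4] at h2
      norm_num at h2
    obtain ⟨s, hs⟩ := h'
    have hs0 : s ≠ 0 := by
      rintro rfl
      simp at hs
      exact hc hs
    have hcs : c = -1 * (s * s) := by linear_combination -hs
    rw [hcs, map_mul, map_mul, mul_pow, hsquare s hs0, map_neg, map_one,
      octic_sq_neg_one hq hK hM₈, mul_one]

/-- On elements of norm one, the quartic character `M₈ ^ 2` is a quadratic character of the base
field, evaluated at `N (1 + v)`. -/
lemma octic_sq_of_norm_eq_one (hq : Fintype.card F % 4 = 3) (hK : Module.finrank F K = 2)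
    (hM₈ : orderOf M₈ = 8) {v : K} (hv : Algebra.norm F v = 1) (hv1 : 1 + v ≠ 0) :
    M₈ v ^ 2 = quadChar F (Algebra.norm F (1 + v)) := by
  have hvq : v * v ^ Fintype.card F = 1 := by
    rw [← algebraMap_norm_eq hK, hv, map_one]
  have hfrob : (1 + v) ^ Fintype.card F = 1 + v ^ Fintype.card F := by
    have h := map_add (FiniteField.frobeniusAlgHom F K) 1 v
    simpa only [map_one, FiniteField.coe_frobeniusAlgHom] using h
  -- Norm one means v^q = v⁻¹, so v is the Hilbert 90 quotient (1 + v)/(1 + v)^q; then M₈(v)² = M₈(1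
  -- + v)^(2 - 6) = M₈(1 + v)⁴.
  have hy : v * (1 + v) ^ Fintype.card F = 1 + v := by
    rw [hfrob]
    linear_combination hvq
  have h1 : M₈ v ^ 2 * M₈ (1 + v) ^ 6 = M₈ (1 + v) ^ 2 := by
    rw [← octic_pow_card (F := F) hq hM₈, ← mul_pow, ← map_mul, hy]
  rw [← octic_pow_four hq hK hM₈]
  have h8 := octic_pow_eight hM₈ hv1
  linear_combination M₈ (1 + v) ^ 2 * h1 - M₈ v ^ 2 * h8

/-- With v = a + bi on the unit circle, N(1 + v) = 2 + 2a and the other norm also depends on a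
alone. Summing over b gives 1 + φ(1 - a²), which turns φ(2 + 2a) into φ(2 + 2a) + φ(2 - 2a); the
symmetry a ↦ -a produces the factor 2. -/
lemma sum_norm_eq_one (hq : Fintype.card F % 4 = 3) (hK : Module.finrank F K = 2)
    (hM₈ : orderOf M₈ = 8) (j : F) :
    ∑ v : K, (if Algebra.norm F v = 1 then
        M₈ v ^ 2 * quadChar F (Algebra.norm F (1 - (algebraMap F K j * v) ^ 2)) else 0) =
      2 * ∑ a : F, quadChar F (2 + 2 * a) *
        quadChar F ((1 + j ^ 2) ^ 2 - 4 * j ^ 2 * a ^ 2) := by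
  have hF : ringChar F ≠ 2 := ringChar_ne_two_of_odd_card (by omega)
  obtain ⟨i, hi, hN, hbij⟩ := exists_coordinates (K := K) hq hK
  -- The value 1 at a = -1 is M₈(-1)²: there v = -1 and 1 + v = 0, so the formula through N(1 + v)
  -- fails.
  have hterm : ∀ a b : F, (if Algebra.norm F (algebraMap F K a + algebraMap F K b * i) = 1 then
        M₈ (algebraMap F K a + algebraMap F K b * i) ^ 2 * quadChar F (Algebra.norm F
          (1 - (algebraMap F K j * (algebraMap F K a + algebraMap F K b * i)) ^ 2)) else 0) =
      (if b ^ 2 = 1 - a ^ 2 then 1 else 0) * ((if a = -1 then 1 else quadChar F (2 + 2 * a)) *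
        quadChar F ((1 + j ^ 2) ^ 2 - 4 * j ^ 2 * a ^ 2)) := by
    intro a b
    by_cases hab : a ^ 2 + b ^ 2 = 1
    · have hb : b ^ 2 = 1 - a ^ 2 := by linear_combination hab
      rw [if_pos (by rw [hN, hab]), if_pos hb, one_mul]
      congr 1
      · split_ifs with ha
        · have hb0 : b = 0 := by
            rw [ha] at hb
            simpa using hb
          subst ha hb0
          simpa using octic_sq_neg_one hq hK hM₈
        · have h1v : 1 + (algebraMap F K a + algebraMap F K b * i) =
              algebraMap F K (1 + a) + algebraMap F K b * i := by
            rw [map_add, map_one]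
            ring
          have hN1 : Algebra.norm F (1 + (algebraMap F K a + algebraMap F K b * i)) = 2 + 2 * a := by
            rw [h1v, hN]
            linear_combination hab
          rw [octic_sq_of_norm_eq_one hq hK hM₈ (by rw [hN, hab]), hN1]
          intro h0
          rw [h0, Algebra.norm_zero] at hN1
          have h2 : 2 * (1 + a) = 0 := by linear_combination -hN1
          rcases mul_eq_zero.mp h2 with h | h
          · exact Ring.two_ne_zero hF h
          · exact ha (by linear_combination h)
      · have he : 1 - (algebraMap F K j * (algebraMap F K a + algebraMap F K b * i)) ^ 2 =
            algebraMap F K (1 - j ^ 2 * (a ^ 2 - b ^ 2)) + algebraMap F K (-2 * j ^ 2 * a * b) * i := by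
          simp only [map_sub, map_mul, map_pow, map_one, map_neg, map_ofNat]
          linear_combination -(algebraMap F K j) ^ 2 * (algebraMap F K b) ^ 2 * hi
        rw [he, hN]
        congr 1
        have : b ^ 4 = (1 - a ^ 2) ^ 2 := by rw [← hb]; ring
        linear_combination (2 * j ^ 2 + 2 * j ^ 4 * a ^ 2) * hb + j ^ 4 * this
    · rw [if_neg (by rwa [hN]), if_neg (fun h => hab (by linear_combination h)), zero_mul]
  rw [← hbij.sum_comp, Fintype.sum_prod_type]
  simp_rw [hterm, ← Finset.sum_mul, sum_ite_sq_eq hF]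
  have hsplit : ∀ a : F, (1 + quadChar F (1 - a ^ 2)) *
      ((if a = -1 then 1 else quadChar F (2 + 2 * a)) *
        quadChar F ((1 + j ^ 2) ^ 2 - 4 * j ^ 2 * a ^ 2)) =
      quadChar F (2 + 2 * a) * quadChar F ((1 + j ^ 2) ^ 2 - 4 * j ^ 2 * a ^ 2) +
      quadChar F (2 + 2 * -a) * quadChar F ((1 + j ^ 2) ^ 2 - 4 * j ^ 2 * (-a) ^ 2) := by
    intro a
    rw [neg_sq, ← mul_assoc, ← add_mul]
    congr 1
    split_ifs with ha
    · subst ha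
      have h4 := quadChar_four hF
      norm_num [h4, MulChar.map_zero]
    · have e1 : 1 - a ^ 2 = (1 - a) * (1 + a) := by ring
      have e2 : 2 + 2 * a = 2 * (1 + a) := by ring
      have e3 : 2 + 2 * -a = 2 * (1 - a) := by ring
      have hs : quadChar F (1 + a) ^ 2 = 1 :=
        quadChar_sq_apply fun h => ha (by linear_combination h)
      rw [e1, e2, e3]
      simp only [map_mul]
      linear_combination quadChar F 2 * quadChar F (1 - a) * hs
  rw [Finset.sum_congr rfl fun a _ => hsplit a, Finset.sum_add_distrib, two_mul]
  congr 1
  exact Equiv.sum_comp (Equiv.neg F) fun a : F => quadChar F (2 + 2 * a) *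
    quadChar F ((1 + j ^ 2) ^ 2 - 4 * j ^ 2 * a ^ 2)

/-- The sum of the two Jacobi sums as a single sum over square roots. -/
lemma jacobiSum_add_jacobiSum (hq : Fintype.card F % 4 = 3) (hK : Module.finrank F K = 2)
    (hM₈ : orderOf M₈ = 8) (ν : MulChar F ℂ) :
    jacobiSum (ν.compNorm K * M₈) ((quadChar F).compNorm K) +
        jacobiSum (ν.compNorm K * M₈ ^ 5) ((quadChar F).compNorm K) =
      ∑ w : K, ν (Algebra.norm F w) ^ 2 * M₈ w ^ 2 *
        quadChar F (Algebra.norm F (1 - w ^ 2)) := by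
  classical
  have hF : ringChar F ≠ 2 := ringChar_ne_two_of_odd_card (by omega)
  have hFK := ringChar_ne_two_of_finrank hq hK
  have h := sum_comp_sq hFK fun z : K =>
    ν (Algebra.norm F z) * M₈ z * quadChar F (Algebra.norm F (1 - z))
  simp only [map_pow] at h
  rw [h, jacobiSum, jacobiSum, ← Finset.sum_add_distrib]
  refine Finset.sum_congr rfl fun z _ => ?_
  rw [← quadChar_compNorm hF hFK]
  simp only [MulChar.mul_apply, compNorm_apply, MulChar.pow_apply' _ (show (5 : ℕ) ≠ 0 by norm_num)]
  rw [← octic_pow_four hq hK hM₈ z]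
  ring

/-- Substituting w ↦ w^q fixes all norms and replaces M₈(w)² by M₈(w)⁶ = M₈(w)² φ(N w). -/
lemma sum_mul_quadChar_norm (hq : Fintype.card F % 4 = 3) (hK : Module.finrank F K = 2)
    (hM₈ : orderOf M₈ = 8) (ν : MulChar F ℂ) :
    ∑ w : K, ν (Algebra.norm F w) ^ 2 * M₈ w ^ 2 *
        quadChar F (Algebra.norm F (1 - w ^ 2)) * quadChar F (Algebra.norm F w) =
      ∑ w : K, ν (Algebra.norm F w) ^ 2 * M₈ w ^ 2 *
        quadChar F (Algebra.norm F (1 - w ^ 2)) := by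
  have hbij : Function.Bijective fun w : K => w ^ Fintype.card F := by
    rw [← FiniteField.coe_frobeniusAlgHom]
    exact Finite.injective_iff_bijective.mp (FiniteField.frobeniusAlgHom F K).injective
  rw [← hbij.sum_comp fun w : K => ν (Algebra.norm F w) ^ 2 * M₈ w ^ 2 *
        quadChar F (Algebra.norm F (1 - w ^ 2))]
  refine Finset.sum_congr rfl fun w _ => ?_
  have he : 1 - (w ^ Fintype.card F) ^ 2 = (1 - w ^ 2) ^ Fintype.card F := by
    have h := map_sub (FiniteField.frobeniusAlgHom F K) 1 (w ^ 2)
    simp only [map_one, map_pow, FiniteField.coe_frobeniusAlgHom] at h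
    exact h.symm
  rw [he, norm_pow_card, norm_pow_card, octic_pow_card hq hM₈, ← octic_pow_four hq hK hM₈ w]
  ring

/-- The fibre N w = j² is j times the unit circle, and M₈(j)² = 1 while ν(N w)² = ν(j)⁴. -/
lemma sum_norm_eq_sq (hq : Fintype.card F % 4 = 3) (hK : Module.finrank F K = 2)
    (hM₈ : orderOf M₈ = 8) (ν : MulChar F ℂ) {j : F} (hj : j ≠ 0) :
    ∑ w : K, (if j ^ 2 = Algebra.norm F w then ν (Algebra.norm F w) ^ 2 * M₈ w ^ 2 *
        quadChar F (Algebra.norm F (1 - w ^ 2)) else 0) =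
      2 * (quadChar F j * ν j ^ 4 * ∑ x : F, quadChar F x * quadChar F (1 - x) *
        quadChar F (x * (j + 1) ^ 2 + (j - 1) ^ 2)) := by
  have hj' : algebraMap F K j ≠ 0 := by simpa using hj
  rw [← Equiv.sum_comp (Equiv.mulLeft₀ (algebraMap F K j) hj')]
  have hterm : ∀ v : K, (if j ^ 2 = Algebra.norm F (algebraMap F K j * v) then
      ν (Algebra.norm F (algebraMap F K j * v)) ^ 2 * M₈ (algebraMap F K j * v) ^ 2 *
        quadChar F (Algebra.norm F (1 - (algebraMap F K j * v) ^ 2)) else 0) =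
      ν j ^ 4 * (if Algebra.norm F v = 1 then
        M₈ v ^ 2 * quadChar F (Algebra.norm F (1 - (algebraMap F K j * v) ^ 2)) else 0) := by
    intro v
    have hNv : Algebra.norm F (algebraMap F K j * v) = j ^ 2 * Algebra.norm F v := by
      rw [map_mul, Algebra.norm_algebraMap, hK]
    by_cases hv : Algebra.norm F v = 1
    · rw [hNv, hv, mul_one, if_pos rfl, if_pos rfl, map_pow, map_mul, mul_pow,
        octic_sq_algebraMap hq hK hM₈ hj]
      ring
    · rw [if_neg hv, if_neg, mul_zero]
      rw [hNv]
      intro h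
      exact hv (mul_left_cancel₀ (pow_ne_zero 2 hj) (by rw [← h, mul_one]))
  refine (Finset.sum_congr rfl fun v _ => hterm v).trans ?_
  rw [ ← Finset.mul_sum, sum_norm_eq_one hq hK hM₈ j,
    ← quadChar_mul_sum_cubic hq hj]
  ring

end Octic

theorem theorem5p4 {F K : Type*} [Field F] [Fintype F] [DecidableEq F] [Field K] [Fintype K]
    [Algebra F K] (hq : Fintype.card F % 4 = 3) (hK : Module.finrank F K = 2)
    (M₈ : MulChar K ℂ) (hM₈ : orderOf M₈ = 8) (ν : MulChar F ℂ) :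
    ∑ j : Fˣ, ∑ x : Fˣ,
        (quadChar F * ν ^ 4) (j : F) * quadChar F (x : F) * quadChar F (1 - (x : F)) *
          quadChar F ((x : F) * ((j : F) + 1) ^ 2 + ((j : F) - 1) ^ 2) =
      jacobiSum (ν.compNorm K * M₈) ((quadChar F).compNorm K) +
        jacobiSum (ν.compNorm K * M₈ ^ 5) ((quadChar F).compNorm K) := by
  have hF : ringChar F ≠ 2 := ringChar_ne_two_of_odd_card (by omega)
  have hL : ∀ j : Fˣ, ∑ x : Fˣ,
      (quadChar F * ν ^ 4) (j : F) * quadChar F (x : F) * quadChar F (1 - (x : F)) *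
          quadChar F ((x : F) * ((j : F) + 1) ^ 2 + ((j : F) - 1) ^ 2) =
      quadChar F (j : F) * ν (j : F) ^ 4 * ∑ x : F, quadChar F x * quadChar F (1 - x) *
        quadChar F (x * ((j : F) + 1) ^ 2 + ((j : F) - 1) ^ 2) := by
    intro j
    rw [← sum_units_eq_sum (F := F) (g := fun x => quadChar F x * quadChar F (1 - x) *
      quadChar F (x * ((j : F) + 1) ^ 2 + ((j : F) - 1) ^ 2)) (by simp [MulChar.map_zero]), Finset.mul_sum]
    refine Finset.sum_congr rfl fun x _ => ?_
    rw [MulChar.mul_apply, MulChar.pow_apply_coe]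
    ring
  rw [Finset.sum_congr rfl fun j _ => hL j, jacobiSum_add_jacobiSum hq hK hM₈ ν]
  apply mul_left_cancel₀ (two_ne_zero (α := ℂ))
  conv_rhs => rw [two_mul]
  -- Only one of the two copies of S is twisted, so that together they carry 1 + φ(N w).
  nth_rw 2 [← sum_mul_quadChar_norm hq hK hM₈ ν]
  rw [← Finset.sum_add_distrib]
  have hR : ∀ w : K, ν (Algebra.norm F w) ^ 2 * M₈ w ^ 2 *
        quadChar F (Algebra.norm F (1 - w ^ 2)) + ν (Algebra.norm F w) ^ 2 * M₈ w ^ 2 *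
        quadChar F (Algebra.norm F (1 - w ^ 2)) * quadChar F (Algebra.norm F w) =
      ∑ j : F, if j ^ 2 = Algebra.norm F w then ν (Algebra.norm F w) ^ 2 * M₈ w ^ 2 *
        quadChar F (Algebra.norm F (1 - w ^ 2)) else 0 := by
    intro w
    rw [← mul_one_add, ← sum_ite_sq_eq hF, Finset.mul_sum]
    simp only [mul_ite, mul_one, mul_zero]
  rw [Finset.sum_congr rfl fun w _ => hR w, Finset.sum_comm, ← sum_units_eq_sum (F := F), Finset.mul_sum]
  · exact Finset.sum_congr rfl fun j _ => (sum_norm_eq_sq hq hK hM₈ ν j.ne_zero).symm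
  -- The term j = 0 vanishes: N w = 0 forces w = 0, where M₈ is 0.
  · refine Finset.sum_eq_zero fun w _ => ?_
    split_ifs with h
    · have hw : w = 0 := by
        rw [← Algebra.norm_eq_zero_iff (R := F), ← h]
        simp
      simp [hw, MulChar.map_zero]
    · rfl
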